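/- Let $\mathbb K$ be $\mathbb R$ or $\mathbb C$; all spaces are over $\mathbb K$. For Banach spaces $X,Y$ let $S_X$ be the unit sphere of $X$, let $\mathcal L(X,Y)$ be the space of bounded linear operators with the operator norm, and put $$\Pi(X,Y)=\{(x,T)\in X\times\mathcal L(X,Y): \|T\|=\|x\|=\|Tx\|=1\}.$$ For $0<\varepsilon<1$ let $$\eta(X,Y)(\varepsilon)=\inf\bigl\{1-\|Tx\| : x\in S_X,\ T\in\mathcal L(X,Y),\ \|T\|=1,\ \operatorname{dist}\bigl((x,T),\Pi(X,Y)\bigr)\ge\varepsilon\bigr\}\in[0,\infty],$$ where $\operatorname{dist}((x,T),\Pi(X,Y))=\inf\{\max\{\|x-y\|,\|T-S\|\} : (y,S)\in\Pi(X,Y)\}$ and $\inf\emptyset=+\infty$. The pair $(X,Y)$ has the Bishop-Phelps-Bollobás property (BPBp) if for every $0<\varepsilon<1$ there is $\delta>0$ such that for all $T\in\mathcal L(X,Y)$ with $\|T\|=1$ and all $x_0\in S_X$ with $\|Tx_0\|>1-\delta$ there are $S\in\mathcal L(X,Y)$ with $\|S\|=1$ and $y_0\in S_X$ such that $\|Sy_0\|=1$,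 $\|y_0-x_0\|<\varepsilon$ and $\|S-T\|<\varepsilon$. **Proposition 2.1.** Let $\eta:(0,1)\to(0,\infty)$ be a function. 1. Let $Y$ be a Banach space. Suppose that $\eta(L_1(m),Y)(\varepsilon)\ge\eta(\varepsilon)$ for all $0<\varepsilon<1$ and for every positive finite regular Borel measure $m$ on a compact Hausdorff space. Then for every measure $\mu$ (on an arbitrary measurable space) the pair $(L_1(\mu),Y)$ has the BPBp, and $\eta(L_1(\mu),Y)(\varepsilon)\ge\eta(\varepsilon)$ for all $0<\varepsilon<1$. 2. Suppose that $\eta(L_1(m_1),L_1(m_2))(\varepsilon)\ge\eta(\varepsilon)$ for all $0<\varepsilon<1$ and for all positive finite regular Borel measures $m_1$ and $m_2$ on compact Hausdorff spaces. Then for all measures $\mu$ and $\nu$ the pair $(L_1(\mu),L_1(\nu))$ has the BPBp, and $\eta(L_1(\mu),L_1(\nu))(\varepsilon)\ge\eta(\varepsilon)$ for all $0<\varepsilon<1$. -/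

import Mathlib

open MeasureTheory
open scoped ENNReal

universe u v w z

namespace BishopPhelpsBollobas

section

variable (𝕜 : Type*) [RCLike 𝕜]
  (X : Type*) [NormedAddCommGroup X] [NormedSpace 𝕜 X]
  (Y : Type*) [NormedAddCommGroup Y] [NormedSpace 𝕜 Y]

/-- The Bishop-Phelps-Bollobás property of the pair `(X, Y)` of spaces over `𝕜`. -/
def HasBPBp : Prop :=
  ∀ ε : ℝ, 0 < ε → ε < 1 → ∃ η : ℝ, 0 < η ∧
    ∀ (T : X →L[𝕜] Y) (x₀ : X), ‖T‖ = 1 → ‖x₀‖ = 1 → 1 - η < ‖T x₀‖ →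
      ∃ (S : X →L[𝕜] Y) (y₀ : X), ‖S‖ = 1 ∧ ‖y₀‖ = 1 ∧
        ‖S y₀‖ = 1 ∧ ‖y₀ - x₀‖ < ε ∧ ‖S - T‖ < ε

/-- The set `Π(X, Y)` of the pairs `(x, T)` with `‖T‖ = ‖x‖ = ‖T x‖ = 1`. -/
def attainingPairs : Set (X × (X →L[𝕜] Y)) :=
  {p | ‖p.2‖ = 1 ∧ ‖p.1‖ = 1 ∧ ‖p.2 p.1‖ = 1}

/-- The modulus `η(X, Y)(ε)`: the infimum of `1 - ‖T x‖` over the norm-one `x` and `T` such that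
`(x, T)` has distance at least `ε` from `Π(X, Y)`. The distance is the one of the product, that is,
`max ‖x - y‖ ‖T - S‖`. Values are taken in `[0, ∞]`, where an infimum over the empty set is `∞`. -/
noncomputable def modulus (ε : ℝ) : ℝ≥0∞ :=
  sInf {r | ∃ (x : X) (T : X →L[𝕜] Y), ‖x‖ = 1 ∧ ‖T‖ = 1 ∧
    ENNReal.ofReal ε ≤ Metric.infEDist (x, T) (attainingPairs 𝕜 X Y) ∧
    r = ENNReal.ofReal (1 - ‖T x‖)}

end

end BishopPhelpsBollobas

/-! The bound on the modulus says exactly that every norm-one pair `(x, T)` with `1 - ‖T x‖ < η ε`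
has an attaining pair within `ε` (`ofReal_le_modulus_iff`), and one pair only sees countably much of
`L¹(μ)`.

Domain: `x` and a norming sequence for `T` live in a band isometric to `L¹` of a finite measure
(`exists_finite_band`). Approximate there and keep `T` on the complementary band. Norms add across
the two bands, so neither the norm of the operator nor the distance to `T` grows.

Codomain: once the domain measure is finite, `A ↦ T 1_A` has finite variation. Partitions nearly
exhausting this variation give countably many vectors whose band contains the whole range of `T`,
even if that range is not separable.

Finally, `L¹` of a finite measure is `L¹` of a regular Borel measure on a compact cube, by
Stone-Weierstrass and Riesz representation (`exists_compact_L1_equiv`). -/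

namespace BishopPhelpsBollobas

/-! ### Transfer of approximating pairs along isometries and L-projections. -/

section Abstract

variable {𝕜 : Type*} [RCLike 𝕜]
  {X : Type*} [NormedAddCommGroup X] [NormedSpace 𝕜 X]
  {X₁ : Type*} [NormedAddCommGroup X₁] [NormedSpace 𝕜 X₁]
  {Y : Type*} [NormedAddCommGroup Y] [NormedSpace 𝕜 Y]
  {Y₁ : Type*} [NormedAddCommGroup Y₁] [NormedSpace 𝕜 Y₁]

/-- The pair `(x, T)` has distance less than `ε` from `Π(X, Y)`. -/
def IsNearAttaining (ε : ℝ) (x : X) (T : X →L[𝕜] Y) : Prop :=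
  ∃ (y : X) (S : X →L[𝕜] Y), ‖S‖ = 1 ∧ ‖y‖ = 1 ∧ ‖S y‖ = 1 ∧ ‖x - y‖ < ε ∧ ‖T - S‖ < ε

variable (𝕜 X Y) in
/-- Every norm-one pair `(x, T)` with `1 - ‖T x‖ < r` has distance less than `ε` from `Π(X, Y)`. -/
def HasApproximants (r ε : ℝ) : Prop :=
  ∀ (x : X) (T : X →L[𝕜] Y), ‖x‖ = 1 → ‖T‖ = 1 → 1 - ‖T x‖ < r → IsNearAttaining ε x T

theorem infEDist_attainingPairs_lt_iff {ε : ℝ} (hε : 0 < ε) (x : X) (T : X →L[𝕜] Y) :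
    Metric.infEDist (x, T) (attainingPairs 𝕜 X Y) < ENNReal.ofReal ε ↔ IsNearAttaining ε x T := by
  rw [Metric.infEDist_lt_iff]
  constructor
  · rintro ⟨⟨y, S⟩, ⟨hS, hy, hSy⟩, h⟩
    rw [edist_dist, ENNReal.ofReal_lt_ofReal_iff hε, Prod.dist_eq, max_lt_iff, dist_eq_norm,
      dist_eq_norm] at h
    exact ⟨y, S, hS, hy, hSy, h.1, h.2⟩
  · rintro ⟨y, S, hS, hy, hSy, h₁, h₂⟩
    refine ⟨(y, S), ⟨hS, hy, hSy⟩, ?_⟩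
    rw [edist_dist, ENNReal.ofReal_lt_ofReal_iff hε, Prod.dist_eq, max_lt_iff, dist_eq_norm,
      dist_eq_norm]
    exact ⟨h₁, h₂⟩

theorem ofReal_le_modulus_iff {r ε : ℝ} (hr : 0 < r) (hε : 0 < ε) :
    ENNReal.ofReal r ≤ modulus 𝕜 X Y ε ↔ HasApproximants 𝕜 X Y r ε := by
  constructor
  · intro h x T hx hT hxT
    rw [← infEDist_attainingPairs_lt_iff hε]
    by_contra! hfar
    have h₁ := h.trans (sInf_le ⟨x, T, hx, hT, hfar, rfl⟩)
    exact absurd ((ENNReal.ofReal_lt_ofReal_iff hr).2 hxT) (not_lt.2 h₁)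
  · intro h
    refine le_sInf ?_
    rintro _ ⟨x, T, hx, hT, hfar, rfl⟩
    refine ENNReal.ofReal_le_ofReal ?_
    by_contra! hlt
    exact absurd ((infEDist_attainingPairs_lt_iff hε x T).2 (h x T hx hT hlt)) (not_lt.2 hfar)

theorem hasBPBp_of_hasApproximants {η : ℝ → ℝ} (hη : ∀ ε : ℝ, 0 < ε → ε < 1 → 0 < η ε)
    (h : ∀ ε : ℝ, 0 < ε → ε < 1 → HasApproximants 𝕜 X Y (η ε) ε) : HasBPBp 𝕜 X Y := by
  intro ε h₀ h₁
  refine ⟨η ε, hη ε h₀ h₁, fun T x hT hx hTx ↦ ?_⟩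
  obtain ⟨y, S, hS, hy, hSy, hxy, hTS⟩ := h ε h₀ h₁ x T hx hT (by linarith)
  exact ⟨S, y, hS, hy, hSy, by rwa [norm_sub_rev], by rwa [norm_sub_rev]⟩

theorem exists_comp_eq_of_linearIsometry (J : Y₁ →ₗᵢ[𝕜] Y) (T : X →L[𝕜] Y)
    (h : ∀ x, ∃ u, J u = T x) : ∃ T₁ : X →L[𝕜] Y₁, ∀ x, J (T₁ x) = T x := by
  choose g hg using h
  let G : X →ₗ[𝕜] Y₁ :=
    { toFun := g
      map_add' := fun x y ↦ J.injective (by simp [hg])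
      map_smul' := fun c x ↦ J.injective (by simp [hg]) }
  refine ⟨G.mkContinuous ‖T‖ fun x ↦ ?_, hg⟩
  rw [← J.norm_map]
  exact (congrArg norm (hg x)).trans_le (T.le_opNorm x)

theorem IsNearAttaining.linearIsometry_comp {ε : ℝ} {x : X} {T₁ : X →L[𝕜] Y₁}
    (h : IsNearAttaining ε x T₁) (J : Y₁ →ₗᵢ[𝕜] Y) {T : X →L[𝕜] Y}
    (hT : ∀ x, J (T₁ x) = T x) : IsNearAttaining ε x T := by
  obtain ⟨y, S, hS, hy, hSy, hxy, hTS⟩ := h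
  have hT' : T = J.toContinuousLinearMap.comp T₁ := by ext x; simp [hT]
  refine ⟨y, J.toContinuousLinearMap.comp S, ?_, hy, by simpa using hSy, hxy, ?_⟩
  · rw [J.norm_toContinuousLinearMap_comp, hS]
  · rwa [hT', ← ContinuousLinearMap.comp_sub, J.norm_toContinuousLinearMap_comp]

/-- A map `P` satisfying the norm identity of an L-projection. -/
def IsLProj (P : X →L[𝕜] X) : Prop := ∀ x, ‖P x‖ + ‖x - P x‖ = ‖x‖

/-- Glue the approximant `S` on the range of `P` to `T` on the complement. Additivity of the norm
gives `‖S'‖ ≤ 1`, and `T - S'` factors through the contraction `R`. -/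
theorem IsNearAttaining.of_comp_linearIsometry {ε : ℝ} {J : X₁ →ₗᵢ[𝕜] X} {P : X →L[𝕜] X}
    (hP : IsLProj P) (hJ : ∀ x, ∃ u, J u = P x) (hPJ : ∀ u, P (J u) = J u)
    {T : X →L[𝕜] Y} (hT : ‖T‖ = 1) {u : X₁}
    (h : IsNearAttaining ε u (T.comp J.toContinuousLinearMap)) : IsNearAttaining ε (J u) T := by
  obtain ⟨R, hR⟩ := exists_comp_eq_of_linearIsometry J P hJ
  obtain ⟨y, S, hS, hy, hSy, hxy, hTS⟩ := h
  have hRJ : ∀ v, R (J v) = v := fun v ↦ J.injective (by rw [hR, hPJ])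
  have hRn : ∀ x, ‖R x‖ = ‖P x‖ := fun x ↦ by rw [← J.norm_map, hR]
  have hS' : ∀ x, ‖S x‖ ≤ ‖x‖ := fun x ↦ by simpa [hS] using S.le_opNorm x
  have hT' : ∀ x, ‖T x‖ ≤ ‖x‖ := fun x ↦ by simpa [hT] using T.le_opNorm x
  let S' : X →L[𝕜] Y := S.comp R + T.comp (ContinuousLinearMap.id 𝕜 X - P)
  have hS'_apply : ∀ x, S' x = S (R x) + T (x - P x) := fun x ↦ rfl
  have hS'y : S' (J y) = S y := by simp [hS'_apply, hRJ, hPJ]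
  refine ⟨J y, S', ?_, by simpa using hy, by rwa [hS'y], ?_, ?_⟩
  · refine le_antisymm (S'.opNorm_le_bound zero_le_one fun x ↦ ?_) ?_
    · rw [hS'_apply, one_mul]
      calc ‖S (R x) + T (x - P x)‖ ≤ ‖S (R x)‖ + ‖T (x - P x)‖ := norm_add_le _ _
        _ ≤ ‖P x‖ + ‖x - P x‖ := add_le_add ((hS' _).trans (hRn x).le) (hT' _)
        _ = ‖x‖ := hP x
    · have := S'.le_opNorm (J y)
      rwa [hS'y, hSy, J.norm_map, hy, mul_one] at this
  · rwa [← map_sub, J.norm_map]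
  · refine lt_of_le_of_lt ((T - S').opNorm_le_bound (norm_nonneg _) fun x ↦ ?_) hTS
    have : (T - S') x = (T.comp J.toContinuousLinearMap - S) (R x) := by
      simp only [sub_apply, hS'_apply, ContinuousLinearMap.comp_apply,
        LinearIsometry.coe_toContinuousLinearMap, hR, map_sub]
      abel
    rw [this]
    refine (ContinuousLinearMap.le_opNorm _ _).trans ?_
    gcongr
    rw [hRn, ← hP x]
    exact le_add_of_nonneg_right (norm_nonneg _)

theorem HasApproximants.congr {r ε : ℝ} (e : X ≃ₗᵢ[𝕜] X₁) (e' : Y ≃ₗᵢ[𝕜] Y₁)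
    (h : HasApproximants 𝕜 X Y r ε) : HasApproximants 𝕜 X₁ Y₁ r ε := by
  intro x T hx hT hTx
  have key : IsNearAttaining ε (e.toLinearIsometry (e.symm x)) T := by
    -- A surjective isometry is the case of a trivial complement, `P = id`.
    refine IsNearAttaining.of_comp_linearIsometry (P := ContinuousLinearMap.id 𝕜 X₁)
      (fun x ↦ by simp) (fun x ↦ ⟨e.symm x, by simp⟩) (fun u ↦ rfl) hT ?_
    have hTe : ‖T.comp e.toLinearIsometry.toContinuousLinearMap‖ = 1 := by
      rw [← hT]
      exact T.opNorm_comp_linearIsometryEquiv e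
    let T₁ : X →L[𝕜] Y := e'.symm.toLinearIsometry.toContinuousLinearMap.comp
      (T.comp e.toLinearIsometry.toContinuousLinearMap)
    refine IsNearAttaining.linearIsometry_comp (T₁ := T₁) (h _ T₁ (by simpa using hx) ?_ ?_)
      e'.toLinearIsometry fun x ↦ by simp [T₁]
    · rw [LinearIsometry.norm_toContinuousLinearMap_comp, hTe]
    · simpa [T₁] using hTx
  simpa using key

end Abstract

/-! ### Bands of `L¹(μ)` and finite measures with density. -/

section Band

variable {𝕜 : Type*} [RCLike 𝕜] {Ω : Type*} [MeasurableSpace Ω] {μ : Measure Ω}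

/-- Multiplication by the indicator function of a measurable set, on `L¹(μ)`. -/
noncomputable def bandProj (𝕜 : Type*) [RCLike 𝕜] (μ : Measure Ω) {B : Set Ω}
    (hB : MeasurableSet B) : Lp 𝕜 1 μ →L[𝕜] Lp 𝕜 1 μ :=
  LinearMap.mkContinuous
    { toFun := fun f ↦ ((Lp.memLp f).indicator hB).toLp (B.indicator f)
      map_add' := fun f g ↦ by
        ext1
        filter_upwards [((Lp.memLp (f + g)).indicator hB).coeFn_toLp,
          ((Lp.memLp f).indicator hB).coeFn_toLp, ((Lp.memLp g).indicator hB).coeFn_toLp,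
          Lp.coeFn_add (((Lp.memLp f).indicator hB).toLp (B.indicator f))
            (((Lp.memLp g).indicator hB).toLp (B.indicator g)), Lp.coeFn_add f g]
          with x h₁ h₂ h₃ h₄ h₅
        rw [h₁, h₄, Pi.add_apply, h₂, h₃]
        by_cases hx : x ∈ B
        · simp only [Set.indicator_of_mem hx]
          exact h₅
        · simp only [Set.indicator_of_notMem hx, add_zero]
      map_smul' := fun c f ↦ by
        ext1
        filter_upwards [((Lp.memLp (c • f)).indicator hB).coeFn_toLp,
          ((Lp.memLp f).indicator hB).coeFn_toLp,
          Lp.coeFn_smul c (((Lp.memLp f).indicator hB).toLp (B.indicator f)), Lp.coeFn_smul c f]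
          with x h₁ h₂ h₃ h₄
        rw [h₁, RingHom.id_apply, h₃, Pi.smul_apply, h₂]
        by_cases hx : x ∈ B
        · simp only [Set.indicator_of_mem hx]
          exact h₄
        · simp only [Set.indicator_of_notMem hx, smul_zero] } 1 fun f ↦ by
    rw [one_mul]
    refine Lp.norm_le_norm_of_ae_le ?_
    filter_upwards [((Lp.memLp f).indicator hB).coeFn_toLp] with x hx
    exact (congrArg norm hx).trans_le (norm_indicator_le_norm_self _ _)

theorem coeFn_bandProj {B : Set Ω} (hB : MeasurableSet B) (f : Lp 𝕜 1 μ) :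
    bandProj 𝕜 μ hB f =ᵐ[μ] B.indicator f :=
  ((Lp.memLp f).indicator hB).coeFn_toLp

theorem isLProj_bandProj {B : Set Ω} (hB : MeasurableSet B) : IsLProj (bandProj 𝕜 μ hB) := by
  intro f
  rw [L1.norm_eq_integral_norm, L1.norm_eq_integral_norm, L1.norm_eq_integral_norm,
    ← integral_add (L1.integrable_coeFn _).norm (L1.integrable_coeFn _).norm]
  refine integral_congr_ae ?_
  filter_upwards [coeFn_bandProj hB f, Lp.coeFn_sub f (bandProj 𝕜 μ hB f)] with x h₁ h₂
  rw [h₂, Pi.sub_apply, h₁]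
  by_cases hx : x ∈ B <;> simp [hx]

variable (𝕜 μ) in
/-- The map `u ↦ w • u` is an isometry from `L¹(w μ)` to `L¹(μ)`, linear over `𝕜`. -/
noncomputable def withDensityEmbedding {w : Ω → NNReal} (hw : Measurable w) :
    Lp 𝕜 1 (μ.withDensity fun x ↦ w x) →ₗᵢ[𝕜] Lp 𝕜 1 μ where
  toFun := withDensitySMulLI μ hw
  map_add' := map_add _
  map_smul' := fun c u ↦ by
    ext1
    rw [RingHom.id_apply, withDensitySMulLI_apply, withDensitySMulLI_apply]
    filter_upwards [(ae_withDensity_iff hw.coe_nnreal_ennreal).1 (Lp.coeFn_smul c u),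
      (memL1_smul_of_L1_withDensity hw (c • u)).coeFn_toLp,
      Lp.coeFn_smul c ((memL1_smul_of_L1_withDensity hw u).toLp _),
      (memL1_smul_of_L1_withDensity hw u).coeFn_toLp] with x h₁ h₂ h₃ h₄
    rw [h₂, h₃, Pi.smul_apply, h₄]
    rcases eq_or_ne (w x) 0 with hx | hx
    · simp [hx]
    · rw [h₁ (by simpa using hx), Pi.smul_apply, smul_comm]
  norm_map' := (withDensitySMulLI (E := 𝕜) μ hw).norm_map

theorem coeFn_withDensityEmbedding {w : Ω → NNReal} (hw : Measurable w)
    (u : Lp 𝕜 1 (μ.withDensity fun x ↦ w x)) :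
    withDensityEmbedding 𝕜 μ hw u =ᵐ[μ] fun x ↦ w x • u x :=
  (memL1_smul_of_L1_withDensity hw u).coeFn_toLp

theorem measurableSet_ne_zero {w : Ω → NNReal} (hw : Measurable w) :
    MeasurableSet {x | w x ≠ 0} :=
  (hw (measurableSet_singleton 0)).compl

theorem bandProj_withDensityEmbedding {w : Ω → NNReal} (hw : Measurable w)
    (u : Lp 𝕜 1 (μ.withDensity fun x ↦ w x)) :
    bandProj 𝕜 μ (measurableSet_ne_zero hw) (withDensityEmbedding 𝕜 μ hw u) =
      withDensityEmbedding 𝕜 μ hw u := by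
  ext1
  filter_upwards [coeFn_bandProj (measurableSet_ne_zero hw) (withDensityEmbedding 𝕜 μ hw u),
    coeFn_withDensityEmbedding hw u] with x h₁ h₂
  rw [h₁]
  by_cases hx : w x = 0
  · rw [Set.indicator_of_notMem (by simpa using hx), h₂, hx, zero_smul]
  · rw [Set.indicator_of_mem (by simpa using hx)]

theorem exists_withDensityEmbedding_eq {w : Ω → NNReal} (hw : Measurable w) (f : Lp 𝕜 1 μ) :
    ∃ u, withDensityEmbedding 𝕜 μ hw u = bandProj 𝕜 μ (measurableSet_ne_zero hw) f := by
  -- The preimage is `f / w`. The convention `0⁻¹ = 0` makes `w * w⁻¹` the indicator of `{w ≠ 0}`.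
  have hint : Integrable (fun x ↦ (w x)⁻¹ • f x) (μ.withDensity fun x ↦ w x) := by
    rw [integrable_withDensity_iff_integrable_smul hw]
    refine ((L1.integrable_coeFn f).indicator (measurableSet_ne_zero hw)).congr
      (Filter.Eventually.of_forall fun x ↦ ?_)
    by_cases hx : w x = 0
    · simp [hx]
    · simp [hx, smul_smul]
  refine ⟨hint.toL1 _, ?_⟩
  ext1
  filter_upwards [coeFn_bandProj (measurableSet_ne_zero hw) f,
    coeFn_withDensityEmbedding hw (hint.toL1 _),
    (ae_withDensity_iff hw.coe_nnreal_ennreal).1 hint.coeFn_toL1] with x h₁ h₂ h₃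
  rw [h₁, h₂]
  by_cases hx : w x = 0
  · simp [hx]
  · rw [h₃ (by simpa using hx)]
    simp [hx, smul_smul]

/-- Take `w = ∑ cₙ |fₙ|` with positive weights making the integral less than `1`. Truncation to
`NNReal` creates new zeros only where the sum is infinite, a null set. -/
theorem exists_density_of_seq (f : ℕ → Lp 𝕜 1 μ) :
    ∃ w : Ω → NNReal, Measurable w ∧ ∫⁻ x, w x ∂μ ≠ ∞ ∧
      ∀ n, ∀ᵐ x ∂μ, w x = 0 → f n x = 0 := by
  obtain ⟨c, hc₀, hc⟩ := ENNReal.exists_pos_tsum_mul_lt_of_countable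
    (ε := 1) one_ne_zero (fun n ↦ ∫⁻ x, ‖f n x‖ₑ ∂μ)
    fun n ↦ (L1.integrable_coeFn (f n)).hasFiniteIntegral.ne
  have hm : ∀ n, Measurable fun x ↦ ‖f n x‖ₑ :=
    fun n ↦ (Lp.stronglyMeasurable (f n)).measurable.enorm
  let W : Ω → ℝ≥0∞ := fun x ↦ ∑' n, (c n : ℝ≥0∞) * ‖f n x‖ₑ
  have hW : Measurable W := Measurable.tsum fun n ↦ (hm n).const_mul _
  have hWint : ∫⁻ x, W x ∂μ < 1 := by
    rw [lintegral_tsum fun n ↦ ((hm n).const_mul _).aemeasurable]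
    simp_rw [lintegral_const_mul _ (hm _), mul_comm (c _ : ℝ≥0∞)]
    exact hc
  have hWfin := ae_lt_top hW (hWint.trans ENNReal.one_lt_top).ne
  refine ⟨fun x ↦ (W x).toNNReal, hW.ennreal_toNNReal, ?_, fun n ↦ ?_⟩
  · refine ((lintegral_mono fun x ↦ ?_).trans_lt (hWint.trans ENNReal.one_lt_top)).ne
    exact ENNReal.coe_toNNReal_le_self
  · filter_upwards [hWfin] with x hx h0
    have : W x = 0 := by
      rcases (ENNReal.toNNReal_eq_zero_iff _).1 h0 with h | h
      · exact h
      · exact absurd h hx.ne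
    have := (ENNReal.tsum_eq_zero.1 this) n
    simpa [(hc₀ n).ne'] using this

/-- A countable subset of `L¹(μ)` is contained in a band isometric to `L¹` of a finite measure. -/
theorem exists_finite_band {G : Set (Lp 𝕜 1 μ)} (hG : G.Countable) :
    ∃ (m : Measure Ω) (_ : IsFiniteMeasure m) (J : Lp 𝕜 1 m →ₗᵢ[𝕜] Lp 𝕜 1 μ)
      (P : Lp 𝕜 1 μ →L[𝕜] Lp 𝕜 1 μ), IsLProj P ∧ (∀ f, ∃ u, J u = P f) ∧
      (∀ u, P (J u) = J u) ∧ ∀ f ∈ G, P f = f := by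
  -- Inserting `0` makes the set nonempty, so that a sequence enumerates it.
  obtain ⟨f, hf⟩ := (hG.insert 0).exists_eq_range (Set.insert_nonempty 0 G)
  obtain ⟨w, hw, hwint, hfw⟩ := exists_density_of_seq f
  refine ⟨μ.withDensity fun x ↦ w x, isFiniteMeasure_withDensity hwint,
    withDensityEmbedding 𝕜 μ hw, bandProj 𝕜 μ (measurableSet_ne_zero hw), isLProj_bandProj _,
    exists_withDensityEmbedding_eq hw, bandProj_withDensityEmbedding hw, fun g hg ↦ ?_⟩
  obtain ⟨n, rfl⟩ : g ∈ Set.range f := hf ▸ Set.mem_insert_of_mem _ hg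
  ext1
  filter_upwards [coeFn_bandProj (measurableSet_ne_zero hw) (f n), hfw n] with x h₁ h₂
  rw [h₁]
  by_cases hx : w x = 0
  · rw [h₂ hx, Set.indicator_of_notMem (by simpa using hx)]
  · rw [Set.indicator_of_mem (by simpa using hx)]

end Band

/-! ### Finite variation of `A ↦ T 1_A` and the band of its range. -/

section Variation

variable {𝕜 : Type*} [RCLike 𝕜] {Ω : Type*} [MeasurableSpace Ω] {m : Measure Ω} [IsFiniteMeasure m]

open Classical in
variable (𝕜 m) in
/-- The class in `L¹(m)` of the indicator function of `A`, and `0` if `A` is not measurable. -/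
noncomputable def indL1 (A : Set Ω) : Lp 𝕜 1 m :=
  if h : MeasurableSet A then indicatorConstLp 1 h (measure_ne_top m A) 1 else 0

theorem coeFn_indL1 {A : Set Ω} (hA : MeasurableSet A) :
    indL1 𝕜 m A =ᵐ[m] A.indicator fun _ ↦ (1 : 𝕜) := by
  rw [indL1, dif_pos hA]
  exact indicatorConstLp_coeFn

theorem norm_indL1_le (A : Set Ω) : ‖indL1 𝕜 m A‖ ≤ m.real A := by
  unfold indL1
  split_ifs with h
  · refine norm_indicatorConstLp_le.trans ?_
    simp
  · simp

theorem indicatorConstLp_eq_smul_indL1 {A : Set Ω} (hA : MeasurableSet A) (h : m A ≠ ∞) (c : 𝕜) :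
    indicatorConstLp 1 hA h c = c • indL1 𝕜 m A := by
  ext1
  filter_upwards [indicatorConstLp_coeFn (p := 1) (hs := hA) (hμs := h) (c := c),
    coeFn_indL1 (𝕜 := 𝕜) (m := m) hA, Lp.coeFn_smul c (indL1 𝕜 m A)] with x h₁ h₂ h₃
  rw [h₁, h₃, Pi.smul_apply, h₂]
  by_cases hx : x ∈ A <;> simp [hx]

/-- A finite measurable partition. -/
structure IsMeasurablePartition {ι : Type} (s : ι → Set Ω) : Prop where
  measurableSet : ∀ i, MeasurableSet (s i)
  existsUnique : ∀ x, ∃! i, x ∈ s i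

theorem IsMeasurablePartition.indL1_eq_sum {ι : Type} [Fintype ι] {s : ι → Set Ω}
    (hs : IsMeasurablePartition s) {A : Set Ω} (hA : MeasurableSet A) :
    indL1 𝕜 m A = ∑ i, indL1 𝕜 m (s i ∩ A) := by
  ext1
  have h : ∀ᵐ x ∂m, ∀ i, indL1 𝕜 m (s i ∩ A) x = (s i ∩ A).indicator (fun _ ↦ (1 : 𝕜)) x :=
    ae_all_iff.2 fun i ↦ coeFn_indL1 ((hs.measurableSet i).inter hA)
  filter_upwards [h, coeFn_indL1 (𝕜 := 𝕜) (m := m) hA,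
    Lp.coeFn_finsetSum Finset.univ fun i ↦ indL1 𝕜 m (s i ∩ A)] with x h₁ h₂ h₃
  rw [h₂, h₃, Finset.sum_apply]
  simp_rw [h₁]
  obtain ⟨i, hi, huniq⟩ := hs.existsUnique x
  rw [Finset.sum_eq_single i]
  · by_cases hx : x ∈ A <;> simp [hx, hi]
  · intro j _ hj
    exact Set.indicator_of_notMem (fun h ↦ hj (huniq j h.1)) _
  · simp

theorem isMeasurablePartition_bool {A : Set Ω} (hA : MeasurableSet A) :
    IsMeasurablePartition fun b : Bool ↦ if b then A else Aᶜ where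
  measurableSet b := by cases b <;> simp [hA]
  existsUnique x := by
    by_cases hx : x ∈ A
    · exact ⟨true, by simpa using hx, fun b hb ↦ by cases b <;> simp_all⟩
    · exact ⟨false, by simpa using hx, fun b hb ↦ by cases b <;> simp_all⟩

theorem IsMeasurablePartition.inf {ι κ : Type} {s : ι → Set Ω} {t : κ → Set Ω}
    (hs : IsMeasurablePartition s) (ht : IsMeasurablePartition t) :
    IsMeasurablePartition fun p : ι × κ ↦ s p.1 ∩ t p.2 where
  measurableSet p := (hs.measurableSet p.1).inter (ht.measurableSet p.2)
  existsUnique x := by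
    obtain ⟨i, hi, hi'⟩ := hs.existsUnique x
    obtain ⟨j, hj, hj'⟩ := ht.existsUnique x
    exact ⟨(i, j), ⟨hi, hj⟩, fun p hp ↦ Prod.ext (hi' _ hp.1) (hj' _ hp.2)⟩

theorem IsMeasurablePartition.sum_measureReal_le {ι : Type} [Fintype ι] {s : ι → Set Ω}
    (hs : IsMeasurablePartition s) : ∑ i, m.real (s i) ≤ m.real Set.univ := by
  refine sum_measureReal_le_measureReal_univ (fun i _ ↦ hs.measurableSet i) ?_
  intro i _ j _ hij
  refine Set.disjoint_left.2 fun x hi hj ↦ hij ?_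
  exact (hs.existsUnique x).unique hi hj

variable {Y : Type*} [NormedAddCommGroup Y] [NormedSpace 𝕜 Y]

/-- The sums of `‖T 1_A‖` over the cells `A` of the finite measurable partitions. -/
def partitionSums (T : Lp 𝕜 1 m →L[𝕜] Y) : Set ℝ :=
  {r | ∃ (ι : Type) (_ : Fintype ι) (s : ι → Set Ω), IsMeasurablePartition s ∧
    r = ∑ i, ‖T (indL1 𝕜 m (s i))‖}

theorem bddAbove_partitionSums (T : Lp 𝕜 1 m →L[𝕜] Y) : BddAbove (partitionSums T) := by
  refine ⟨‖T‖ * m.real Set.univ, ?_⟩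
  rintro _ ⟨ι, _, s, hs, rfl⟩
  calc ∑ i, ‖T (indL1 𝕜 m (s i))‖ ≤ ∑ i, ‖T‖ * m.real (s i) :=
        Finset.sum_le_sum fun i _ ↦ (T.le_opNorm _).trans (by gcongr; exact norm_indL1_le _)
    _ = ‖T‖ * ∑ i, m.real (s i) := by rw [Finset.mul_sum]
    _ ≤ _ := by gcongr; exact hs.sum_measureReal_le

theorem partitionSums_nonempty (T : Lp 𝕜 1 m →L[𝕜] Y) : (partitionSums T).Nonempty :=
  ⟨_, Bool, inferInstance, _, isMeasurablePartition_bool MeasurableSet.univ, rfl⟩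

/-- Refine the partition by `A`. The refined sum is at most the supremum, while its `P`-part already
dominates the original sum because `P` fixes the old cells. By additivity of the norm, only the
defect is left for the part off the band. -/
theorem norm_sub_le_of_isLProj {T : Lp 𝕜 1 m →L[𝕜] Y} {P : Y →L[𝕜] Y} (hP : IsLProj P)
    {ι : Type} [Fintype ι] {s : ι → Set Ω} (hs : IsMeasurablePartition s)
    (hPs : ∀ i, P (T (indL1 𝕜 m (s i))) = T (indL1 𝕜 m (s i))) {A : Set Ω}
    (hA : MeasurableSet A) :
    ‖T (indL1 𝕜 m A) - P (T (indL1 𝕜 m A))‖ ≤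
      sSup (partitionSums T) - ∑ i, ‖T (indL1 𝕜 m (s i))‖ := by
  have hQ : ∀ y, ‖y - P y‖ = ‖y‖ - ‖P y‖ := fun y ↦ by linarith [hP y]
  let t : Bool → Set Ω := fun b ↦ if b then A else Aᶜ
  have ht : IsMeasurablePartition t := isMeasurablePartition_bool hA
  have h_refine : ∑ i, ∑ b, ‖T (indL1 𝕜 m (s i ∩ t b))‖ ≤ sSup (partitionSums T) := by
    rw [← Fintype.sum_prod_type']
    exact le_csSup (bddAbove_partitionSums T) ⟨ι × Bool, inferInstance, _, hs.inf ht, rfl⟩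
  have h_cell : ∀ i, ‖T (indL1 𝕜 m (s i))‖ ≤ ∑ b, ‖P (T (indL1 𝕜 m (s i ∩ t b)))‖ := fun i ↦ by
    rw [← hPs i, ht.indL1_eq_sum (hs.measurableSet i), map_sum, map_sum]
    simp_rw [Set.inter_comm (t _)]
    exact norm_sum_le _ _
  have h_sum : T (indL1 𝕜 m A) - P (T (indL1 𝕜 m A)) =
      ∑ i, (T (indL1 𝕜 m (s i ∩ A)) - P (T (indL1 𝕜 m (s i ∩ A)))) := by
    rw [hs.indL1_eq_sum hA, map_sum, map_sum, Finset.sum_sub_distrib]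
  calc ‖T (indL1 𝕜 m A) - P (T (indL1 𝕜 m A))‖
      ≤ ∑ i, ‖T (indL1 𝕜 m (s i ∩ A)) - P (T (indL1 𝕜 m (s i ∩ A)))‖ := by
        rw [h_sum]
        exact norm_sum_le _ _
    _ ≤ ∑ i, ∑ b, ‖T (indL1 𝕜 m (s i ∩ t b)) - P (T (indL1 𝕜 m (s i ∩ t b)))‖ :=
        Finset.sum_le_sum fun i _ ↦ Finset.single_le_sum
          (f := fun b ↦ ‖T (indL1 𝕜 m (s i ∩ t b)) - P (T (indL1 𝕜 m (s i ∩ t b)))‖)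
          (fun b _ ↦ norm_nonneg _) (Finset.mem_univ true)
    _ = ∑ i, ∑ b, ‖T (indL1 𝕜 m (s i ∩ t b))‖ -
          ∑ i, ∑ b, ‖P (T (indL1 𝕜 m (s i ∩ t b)))‖ := by
        simp_rw [hQ, Finset.sum_sub_distrib]
    _ ≤ _ := sub_le_sub h_refine (Finset.sum_le_sum fun i _ ↦ h_cell i)

/-- The range of an operator on `L¹` of a finite measure is fixed by every L-projection
that fixes the elements of a suitable countable set. -/
theorem exists_countable_forall_isLProj (T : Lp 𝕜 1 m →L[𝕜] Y) :
    ∃ G : Set Y, G.Countable ∧ ∀ P : Y →L[𝕜] Y, IsLProj P → (∀ g ∈ G, P g = g) →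
      ∀ f, P (T f) = T f := by
  have h : ∀ k : ℕ, ∃ (ι : Type) (_ : Fintype ι) (s : ι → Set Ω), IsMeasurablePartition s ∧
      sSup (partitionSums T) - 1 / ((k : ℝ) + 1) < ∑ i, ‖T (indL1 𝕜 m (s i))‖ := fun k ↦ by
    obtain ⟨_, ⟨ι, _, s, hs, rfl⟩, hlt⟩ := exists_lt_of_lt_csSup (partitionSums_nonempty T)
      (sub_lt_self (sSup (partitionSums T)) (Nat.one_div_pos_of_nat (α := ℝ) (n := k)))
    exact ⟨ι, _, s, hs, hlt⟩
  choose ι hι s hs hlt using h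
  refine ⟨⋃ k, Set.range fun i ↦ T (indL1 𝕜 m (s k i)),
    Set.countable_iUnion fun k ↦ (Set.finite_range _).countable, fun P hP hPG ↦ ?_⟩
  have key : ∀ A, MeasurableSet A → P (T (indL1 𝕜 m A)) = T (indL1 𝕜 m A) := fun A hA ↦ by
    have hle : ∀ k : ℕ, ‖T (indL1 𝕜 m A) - P (T (indL1 𝕜 m A))‖ ≤ 1 / ((k : ℝ) + 1) := fun k ↦ by
      have := norm_sub_le_of_isLProj hP (hs k)
        (fun i ↦ hPG _ (Set.mem_iUnion.2 ⟨k, Set.mem_range_self i⟩)) hA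
      linarith [hlt k]
    have := ge_of_tendsto' tendsto_one_div_add_atTop_nhds_zero_nat hle
    exact (sub_eq_zero.1 (norm_le_zero_iff.1 this)).symm
  intro f
  induction f using Lp.induction ENNReal.one_ne_top with
  | indicatorConst c hs hμs =>
    rw [Lp.simpleFunc.coe_indicatorConst, indicatorConstLp_eq_smul_indL1, map_smul, map_smul,
      key _ hs]
  | add hf hg _ h₁ h₂ => rw [map_add, map_add, h₁, h₂]
  | isClosed => exact isClosed_eq (P.continuous.comp T.continuous) T.continuous

end Variation

/-! ### Representing a finite measure on a compact cube. -/

section Kakutani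

/-- The product of two-point spaces indexed by the measurable subsets of `Ω`. -/
def SetCube (Ω : Type*) [MeasurableSpace Ω] : Type _ := {A : Set Ω // MeasurableSet A} → Bool

variable {Ω : Type*} [MeasurableSpace Ω]

instance : TopologicalSpace (SetCube Ω) :=
  inferInstanceAs (TopologicalSpace ({A : Set Ω // MeasurableSet A} → Bool))

instance : CompactSpace (SetCube Ω) :=
  inferInstanceAs (CompactSpace ({A : Set Ω // MeasurableSet A} → Bool))

instance : T2Space (SetCube Ω) :=
  inferInstanceAs (T2Space ({A : Set Ω // MeasurableSet A} → Bool))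

instance : MeasurableSpace (SetCube Ω) := borel _

instance : BorelSpace (SetCube Ω) := ⟨rfl⟩

open Classical in
/-- A point of `Ω` as the family of its memberships in the measurable sets. -/
noncomputable def toSetCube (x : Ω) : SetCube Ω := fun A ↦ decide (x ∈ A.1)

variable {𝕜 : Type*} [RCLike 𝕜]

variable (𝕜) in
/-- The coordinate functions of the cube, with values in `{0, 1}`. -/
def SetCube.coord (A : {A : Set Ω // MeasurableSet A}) : C(SetCube Ω, 𝕜) :=
  ⟨fun x ↦ if x A then 1 else 0,
    (continuous_of_discreteTopology (f := fun b : Bool ↦ if b then (1 : 𝕜) else 0)).comp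
      (continuous_apply A)⟩

theorem SetCube.coord_toSetCube (A : {A : Set Ω // MeasurableSet A}) (x : Ω) :
    SetCube.coord 𝕜 A (toSetCube x) = A.1.indicator (fun _ ↦ (1 : 𝕜)) x := by
  by_cases hx : x ∈ A.1 <;> simp [SetCube.coord, toSetCube, hx]

variable (Ω 𝕜) in
/-- The continuous functions on the cube with measurable composition with `toSetCube`. -/
def measurableStarSubalgebra : StarSubalgebra 𝕜 C(SetCube Ω, 𝕜) where
  carrier := {f | Measurable fun x : Ω ↦ f (toSetCube x)}
  mul_mem' hf hg := hf.mul hg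
  add_mem' hf hg := hf.add hg
  algebraMap_mem' _ := measurable_const
  star_mem' hf := continuous_star.measurable.comp hf

/-- The cube may have uncountably many coordinates, so Borel measurability of `toSetCube` is not
available. Coordinates pull back to indicators and separate points, so Stone-Weierstrass and limits
reach every continuous function. -/
theorem measurable_comp_toSetCube (f : C(SetCube Ω, 𝕜)) :
    Measurable fun x : Ω ↦ f (toSetCube x) := by
  have hsep : (measurableStarSubalgebra Ω 𝕜).SeparatesPoints := by
    intro x y hxy
    obtain ⟨A, hA⟩ := Function.ne_iff.1 hxy
    refine ⟨_, ⟨SetCube.coord 𝕜 A, ?_, rfl⟩, ?_⟩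
    · have : (fun x ↦ SetCube.coord 𝕜 A (toSetCube x)) = A.1.indicator fun _ ↦ (1 : 𝕜) :=
        funext (SetCube.coord_toSetCube A)
      change Measurable fun x ↦ SetCube.coord 𝕜 A (toSetCube x)
      rw [this]
      exact measurable_const.indicator A.2
    · cases hx : x A <;> cases hy : y A <;> simp_all [SetCube.coord]
  have htop := ContinuousMap.starSubalgebra_topologicalClosure_eq_top_of_separatesPoints _ hsep
  have hf : f ∈ closure (measurableStarSubalgebra Ω 𝕜 : Set C(SetCube Ω, 𝕜)) := by
    rw [← StarSubalgebra.topologicalClosure_coe, htop]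
    trivial
  obtain ⟨g, hg, hgf⟩ := mem_closure_iff_seq_limit.1 hf
  refine measurable_of_tendsto_metrizable (f := fun n x ↦ g n (toSetCube x)) (fun n ↦ hg n) ?_
  rw [tendsto_pi_nhds]
  intro x
  exact ((continuous_eval_const (toSetCube x)).tendsto f).comp hgf

variable (μ : Measure Ω) [IsFiniteMeasure μ]

theorem integrable_comp_toSetCube (f : C(SetCube Ω, 𝕜)) :
    Integrable (fun x ↦ f (toSetCube x)) μ :=
  Integrable.of_bound (measurable_comp_toSetCube f).aestronglyMeasurable ‖f‖
    (Filter.Eventually.of_forall fun _ ↦ f.norm_coe_le_norm _)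

/-- Riesz representation of `f ↦ ∫ f ∘ toSetCube` replaces the pushforward of `μ`. Real `f` suffice,
since the identity is applied to norms of functions. -/
theorem exists_regular_integral_eq :
    ∃ (m : Measure (SetCube Ω)) (_ : IsFiniteMeasure m) (_ : m.Regular),
      ∀ f : C(SetCube Ω, ℝ), ∫ y, f y ∂m = ∫ x, f (toSetCube x) ∂μ := by
  let Λ : CompactlySupportedContinuousMap (SetCube Ω) ℝ →ₚ[ℝ] ℝ :=
    { toFun := fun g ↦ ∫ x, g (toSetCube x) ∂μ
      map_add' := fun g g' ↦ integral_add (integrable_comp_toSetCube μ g.toContinuousMap)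
        (integrable_comp_toSetCube μ g'.toContinuousMap)
      map_smul' := fun c g ↦ integral_smul c _
      monotone' := fun g g' h ↦ integral_mono (integrable_comp_toSetCube μ g.toContinuousMap)
        (integrable_comp_toSetCube μ g'.toContinuousMap) fun x ↦ h (toSetCube x) }
  refine ⟨RealRMK.rieszMeasure Λ, inferInstance, inferInstance, fun f ↦ ?_⟩
  exact RealRMK.integral_rieszMeasure Λ ⟨f, HasCompactSupport.of_compactSpace _⟩

variable (𝕜) in
/-- Composition with `toSetCube`, as a map into `L¹(μ)`. -/
noncomputable def compToSetCube : C(SetCube Ω, 𝕜) →ₗ[𝕜] Lp 𝕜 1 μ where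
  toFun f := (integrable_comp_toSetCube μ f).toL1 _
  map_add' f g := Integrable.toL1_add _ _ (integrable_comp_toSetCube μ f)
    (integrable_comp_toSetCube μ g)
  map_smul' c f := Integrable.toL1_smul' _ (integrable_comp_toSetCube μ f) c

theorem coeFn_compToSetCube (f : C(SetCube Ω, 𝕜)) :
    compToSetCube 𝕜 μ f =ᵐ[μ] fun x ↦ f (toSetCube x) :=
  (integrable_comp_toSetCube μ f).coeFn_toL1

/-- Every measurable set is a coordinate of the cube, so its indicator is in the range. -/
theorem denseRange_compToSetCube : DenseRange (compToSetCube 𝕜 μ) := by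
  intro f
  change f ∈ closure (LinearMap.range (compToSetCube 𝕜 μ) : Set (Lp 𝕜 1 μ))
  rw [← Submodule.topologicalClosure_coe, SetLike.mem_coe]
  induction f using Lp.induction ENNReal.one_ne_top with
  | @indicatorConst c s hs hμs =>
    have h : indL1 𝕜 μ s = compToSetCube 𝕜 μ (SetCube.coord 𝕜 ⟨s, hs⟩) := by
      ext1
      filter_upwards [coeFn_indL1 (𝕜 := 𝕜) (m := μ) hs,
        coeFn_compToSetCube μ (SetCube.coord 𝕜 ⟨s, hs⟩)] with x h₁ h₂
      rw [h₁, h₂, SetCube.coord_toSetCube]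
    rw [Lp.simpleFunc.coe_indicatorConst, indicatorConstLp_eq_smul_indL1, h]
    exact Submodule.smul_mem _ _ (Submodule.le_topologicalClosure _ (LinearMap.mem_range_self _ _))
  | add hf hg _ h₁ h₂ => exact Submodule.add_mem _ h₁ h₂
  | isClosed => exact Submodule.isClosed_topologicalClosure _

end Kakutani

/-- The `L¹` space of a finite measure is isometric to the `L¹` space of a finite regular Borel
measure on a compact Hausdorff space. -/
theorem exists_compact_L1_equiv (𝕜 : Type*) [RCLike 𝕜] {Ω : Type u} [MeasurableSpace Ω]
    (μ : Measure Ω) [IsFiniteMeasure μ] :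
    ∃ (K : Type u) (_ : TopologicalSpace K) (_ : CompactSpace K) (_ : T2Space K)
      (_ : MeasurableSpace K) (_ : BorelSpace K) (m : Measure K) (_ : IsFiniteMeasure m)
      (_ : m.Regular), Nonempty (Lp 𝕜 1 m ≃ₗᵢ[𝕜] Lp 𝕜 1 μ) := by
  obtain ⟨m, _, _, hm⟩ := exists_regular_integral_eq μ
  refine ⟨SetCube Ω, inferInstance, inferInstance, inferInstance, inferInstance, inferInstance, m,
    inferInstance, inferInstance, ⟨?_⟩⟩
  -- Both `L¹` spaces are completions of the same continuous functions under the same seminorm.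
  refine (LinearEquiv.refl 𝕜 C(SetCube Ω, 𝕜)).extendOfIsometry
    (ContinuousMap.toLp (E := 𝕜) 1 m 𝕜).toLinearMap (compToSetCube 𝕜 μ)
    (ContinuousMap.toLp_denseRange 𝕜 m 𝕜 ENNReal.one_ne_top) (denseRange_compToSetCube μ)
    fun f ↦ ?_
  change ‖compToSetCube 𝕜 μ f‖ = ‖ContinuousMap.toLp (E := 𝕜) 1 m 𝕜 f‖
  rw [L1.norm_eq_integral_norm, L1.norm_eq_integral_norm]
  calc ∫ x, ‖compToSetCube 𝕜 μ f x‖ ∂μ = ∫ x, ‖f (toSetCube x)‖ ∂μ := by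
        refine integral_congr_ae ?_
        filter_upwards [coeFn_compToSetCube μ f] with x hx
        rw [hx]
    _ = ∫ y, ‖f y‖ ∂m := (hm ⟨fun y ↦ ‖f y‖, f.continuous.norm⟩).symm
    _ = ∫ y, ‖ContinuousMap.toLp (E := 𝕜) 1 m 𝕜 f y‖ ∂m := by
        refine integral_congr_ae ?_
        filter_upwards [ContinuousMap.coeFn_toLp (𝕜 := 𝕜) (p := 1) m f] with x hx
        rw [hx]

/-! ### Reduction of domain and codomain to finite measures. -/

section Reduction

variable {𝕜 : Type*} [RCLike 𝕜] {Ω : Type*} [MeasurableSpace Ω]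
  {Y : Type*} [NormedAddCommGroup Y] [NormedSpace 𝕜 Y]

theorem exists_seq_norm_le_of_norm_eq_one {X : Type*} [NormedAddCommGroup X] [NormedSpace 𝕜 X]
    {T : X →L[𝕜] Y} (hT : ‖T‖ = 1) : ∃ f : ℕ → X, ∀ n : ℕ, ‖f n‖ ≤ 1 ∧
      1 - 1 / ((n : ℝ) + 1) < ‖T (f n)‖ := by
  have h : ∀ n : ℕ, ∃ f : X, ‖f‖ ≤ 1 ∧ 1 - 1 / ((n : ℝ) + 1) < ‖T f‖ := fun n ↦ by
    obtain ⟨f, hf, hTf⟩ := T.exists_lt_apply_of_lt_opNorm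
      (r := 1 - 1 / ((n : ℝ) + 1)) (by rw [hT]; exact sub_lt_self _ Nat.one_div_pos_of_nat)
    exact ⟨f, hf.le, hTf⟩
  exact ⟨fun n ↦ (h n).choose, fun n ↦ (h n).choose_spec⟩

theorem hasApproximants_L1_of_finite {r ε : ℝ} (μ : Measure Ω)
    (h : ∀ (m : Measure Ω) [IsFiniteMeasure m], HasApproximants 𝕜 (Lp 𝕜 1 m) Y r ε) :
    HasApproximants 𝕜 (Lp 𝕜 1 μ) Y r ε := by
  intro x T hx hT hTx
  obtain ⟨f, hf⟩ := exists_seq_norm_le_of_norm_eq_one hT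
  obtain ⟨m, _, J, P, hP, hJ, hPJ, hG⟩ :=
    exists_finite_band ((Set.countable_range f).insert x)
  have hmem : ∀ g ∈ insert x (Set.range f), ∃ u, J u = g := fun g hg ↦ by
    obtain ⟨u, hu⟩ := hJ g
    exact ⟨u, hu.trans (hG g hg)⟩
  obtain ⟨u, rfl⟩ := hmem x (Set.mem_insert x _)
  refine IsNearAttaining.of_comp_linearIsometry hP hJ hPJ hT
    (h m u _ (by simpa using hx) (le_antisymm ?_ ?_) (by simpa using hTx))
  · refine ContinuousLinearMap.opNorm_le_bound _ zero_le_one fun v ↦ ?_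
    simpa [hT] using T.le_opNorm (J v)
  -- The norming sequence lies in the band, so restriction to it does not lower the norm of `T`.
  · have hle : ∀ n : ℕ, 1 - 1 / ((n : ℝ) + 1) ≤ ‖T.comp J.toContinuousLinearMap‖ := fun n ↦ by
      obtain ⟨v, hv⟩ := hmem (f n) (Set.mem_insert_of_mem _ (Set.mem_range_self n))
      refine (hf n).2.le.trans ?_
      rw [← hv]
      refine ((T.comp J.toContinuousLinearMap).le_opNorm v).trans
        (mul_le_of_le_one_right (norm_nonneg _) ?_)
      rw [← J.norm_map, hv]
      exact (hf n).1
    have hlim := (tendsto_one_div_add_atTop_nhds_zero_nat (𝕜 := ℝ)).const_sub 1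
    rw [sub_zero] at hlim
    exact le_of_tendsto' hlim hle

/-- `T` factors isometrically through the band of its range, and the approximants found there are
composed back with the embedding. -/
theorem hasApproximants_codomain_L1_of_finite {Ω' : Type*} [MeasurableSpace Ω'] {r ε : ℝ}
    (m : Measure Ω) [IsFiniteMeasure m] (ν : Measure Ω')
    (h : ∀ (m' : Measure Ω') [IsFiniteMeasure m'],
      HasApproximants 𝕜 (Lp 𝕜 1 m) (Lp 𝕜 1 m') r ε) :
    HasApproximants 𝕜 (Lp 𝕜 1 m) (Lp 𝕜 1 ν) r ε := by
  intro x T hx hT hTx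
  obtain ⟨G, hG, hGP⟩ := exists_countable_forall_isLProj T
  obtain ⟨m', _, J, P, hP, hJ, -, hPG⟩ := exists_finite_band hG
  obtain ⟨T₁, hT₁⟩ := exists_comp_eq_of_linearIsometry J T fun f ↦ by
    obtain ⟨u, hu⟩ := hJ (T f)
    exact ⟨u, hu.trans (hGP P hP hPG f)⟩
  have hTJ : T = J.toContinuousLinearMap.comp T₁ := by
    ext1 f
    simp [hT₁]
  refine (h m' x T₁ hx ?_ ?_).linearIsometry_comp J hT₁
  · rw [← J.norm_toContinuousLinearMap_comp, ← hTJ, hT]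
  · rwa [← J.norm_map, hT₁]

end Reduction

end BishopPhelpsBollobas

theorem proposition2p1 {𝕜 : Type z} [RCLike 𝕜] (η : ℝ → ℝ)
    (hη : ∀ ε : ℝ, 0 < ε → ε < 1 → 0 < η ε) :
    (∀ (Y : Type w) [NormedAddCommGroup Y] [NormedSpace 𝕜 Y] [CompleteSpace Y],
      (∀ (K : Type u) [TopologicalSpace K] [CompactSpace K] [T2Space K]
          [MeasurableSpace K] [BorelSpace K] (m : Measure K) [IsFiniteMeasure m] [m.Regular],
        ∀ ε : ℝ, 0 < ε → ε < 1 →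
          ENNReal.ofReal (η ε) ≤ BishopPhelpsBollobas.modulus 𝕜 (Lp 𝕜 1 m) Y ε) →
      ∀ (Ω : Type u) [MeasurableSpace Ω] (μ : Measure Ω),
        BishopPhelpsBollobas.HasBPBp 𝕜 (Lp 𝕜 1 μ) Y ∧
        ∀ ε : ℝ, 0 < ε → ε < 1 →
          ENNReal.ofReal (η ε) ≤ BishopPhelpsBollobas.modulus 𝕜 (Lp 𝕜 1 μ) Y ε) ∧
    ((∀ (K₁ : Type u) [TopologicalSpace K₁] [CompactSpace K₁] [T2Space K₁]
          [MeasurableSpace K₁] [BorelSpace K₁]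
          (m₁ : Measure K₁) [IsFiniteMeasure m₁] [m₁.Regular]
          (K₂ : Type v) [TopologicalSpace K₂] [CompactSpace K₂] [T2Space K₂]
          [MeasurableSpace K₂] [BorelSpace K₂]
          (m₂ : Measure K₂) [IsFiniteMeasure m₂] [m₂.Regular],
        ∀ ε : ℝ, 0 < ε → ε < 1 →
          ENNReal.ofReal (η ε) ≤
            BishopPhelpsBollobas.modulus 𝕜 (Lp 𝕜 1 m₁) (Lp 𝕜 1 m₂) ε) →
      ∀ (Ω₁ : Type u) [MeasurableSpace Ω₁] (μ : Measure Ω₁)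
        (Ω₂ : Type v) [MeasurableSpace Ω₂] (ν : Measure Ω₂),
        BishopPhelpsBollobas.HasBPBp 𝕜 (Lp 𝕜 1 μ) (Lp 𝕜 1 ν) ∧
        ∀ ε : ℝ, 0 < ε → ε < 1 →
          ENNReal.ofReal (η ε) ≤
            BishopPhelpsBollobas.modulus 𝕜 (Lp 𝕜 1 μ) (Lp 𝕜 1 ν) ε) := by
  constructor
  · intro Y _ _ _ h Ω _ μ
    have key : ∀ ε : ℝ, 0 < ε → ε < 1 →
        BishopPhelpsBollobas.HasApproximants 𝕜 (Lp 𝕜 1 μ) Y (η ε) ε := by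
      intro ε h₀ h₁
      refine BishopPhelpsBollobas.hasApproximants_L1_of_finite μ fun m _ ↦ ?_
      obtain ⟨K, _, _, _, _, _, m', _, _, ⟨e⟩⟩ :=
        BishopPhelpsBollobas.exists_compact_L1_equiv 𝕜 m
      exact ((BishopPhelpsBollobas.ofReal_le_modulus_iff (hη ε h₀ h₁) h₀).1
        (h K m' ε h₀ h₁)).congr e (LinearIsometryEquiv.refl 𝕜 Y)
    exact ⟨BishopPhelpsBollobas.hasBPBp_of_hasApproximants hη key, fun ε h₀ h₁ ↦
      (BishopPhelpsBollobas.ofReal_le_modulus_iff (hη ε h₀ h₁) h₀).2 (key ε h₀ h₁)⟩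
  · intro h Ω₁ _ μ Ω₂ _ ν
    have key : ∀ ε : ℝ, 0 < ε → ε < 1 →
        BishopPhelpsBollobas.HasApproximants 𝕜 (Lp 𝕜 1 μ) (Lp 𝕜 1 ν) (η ε) ε := by
      intro ε h₀ h₁
      refine BishopPhelpsBollobas.hasApproximants_L1_of_finite μ fun m _ ↦
        BishopPhelpsBollobas.hasApproximants_codomain_L1_of_finite m ν fun m' _ ↦ ?_
      obtain ⟨K₁, _, _, _, _, _, m₁, _, _, ⟨e₁⟩⟩ :=
        BishopPhelpsBollobas.exists_compact_L1_equiv 𝕜 m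
      obtain ⟨K₂, _, _, _, _, _, m₂, _, _, ⟨e₂⟩⟩ :=
        BishopPhelpsBollobas.exists_compact_L1_equiv 𝕜 m'
      exact ((BishopPhelpsBollobas.ofReal_le_modulus_iff (hη ε h₀ h₁) h₀).1
        (h K₁ m₁ K₂ m₂ ε h₀ h₁)).congr e₁ e₂
    exact ⟨BishopPhelpsBollobas.hasBPBp_of_hasApproximants hη key, fun ε h₀ h₁ ↦
      (BishopPhelpsBollobas.ofReal_le_modulus_iff (hη ε h₀ h₁) h₀).2 (key ε h₀ h₁)⟩
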